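/- Let $K$ be a number field of degree $n$ with ring of integers $\mathcal{O}_K$, let $\xi_1,\dots,\xi_n$ be an integral basis of $\mathcal{O}_K$, and let $p$ be a prime number. Let $F(w)\in\mathbb{Z}[u_1,\dots,u_n][w]$ be the fundamental equation, that is, the characteristic polynomial of the generic integer $w_0=u_1\xi_1+\dots+u_n\xi_n$ (with indeterminates $u_i$); equivalently, $$F(w)=\prod_{\sigma:K\hookrightarrow\mathbb{C}}\bigl(w-(u_1\sigma(\xi_1)+\dots+u_n\sigma(\xi_n))\bigr).$$ Let $$F\equiv \mathfrak{F}_1^{\delta_1}\cdots\mathfrak{F}_h^{\delta_h}\pmod p,\qquad \delta_j\ge 1,$$ be the factorization of $F$ modulo $p$ into pairwise non-associated irreducible elements $\mathfrak{F}_j$ of $\mathbb{F}_p[u_1,\dots,u_n][w]$. For $\kappa\ge 0$ let $\lambda(\kappa)$ be the number of $j$ such that $\mathfrak{F}_j$ has degree $\kappa$ as a polynomial in $w$, and for $\kappa\ge1$ let $\bar g(\kappa)=\frac1\kappa\sum_{d\mid\kappa}\mu(\kappa/d)\,p^d$. For $\theta\in\mathcal{O}_K$ write $\theta^k=\sum_i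 a_{ik}\xi_i$ ($0\le k\le n-1$) with $a_{ik}\in\mathbb{Z}$. The discriminant of $1,\theta,\dots,\theta^{n-1}$ (the equation discriminant of $\theta$) equals $\det(a_{ik})^2\,d_K$, where $d_K$ is the discriminant of $K$; the factor $\det(a_{ik})^2$ is called its inessential divisor. (If $\theta$ generates $K$, then $|\det(a_{ik})|$ is the index of $\mathbb{Z}[\theta]$ in $\mathcal{O}_K$; otherwise the determinant is $0$.) The prime $p$ is called a common inessential discriminant divisor (common index divisor) of $K$ if $p\mid\det(a_{ik})^2$ for every $\theta\in\mathcal{O}_K$. Then: 1. for every $\kappa\ge 0$, $\lambda(\kappa)$ equals the number of distinct prime ideals of $\mathcal{O}_K$ over $p$ with residue degree $\kappa$; 2. for every $\kappa\ge1$, $\bar g(\kappa)$ is the number of monic irreducible polynomials of degree $\kappa$ over $\mathbb{F}_p$; 3. $p$ is a common inessential discriminant divisor of $K$ if and only if $\lambda(\kappa)>\bar g(\kappa)$ for at least one $\kappa$ among the degrees in $w$ of $\mathfrak{F}_1,\dots,\mathfrak{F}_h$. -/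

import Mathlib

open NumberField Polynomial

namespace Hensel

noncomputable section

variable {K : Type*} [Field K] [NumberField K] {n : ℕ}

/-- The matrix, in the integral basis `ξ`, of multiplication by the fundamental form
`w₀ = u₁ξ₁ + ⋯ + uₙξₙ`, where `u₁, …, uₙ` are indeterminates. -/
def fundamentalMatrix (ξ : Module.Basis (Fin n) ℤ (𝓞 K)) :
    Matrix (Fin n) (Fin n) (MvPolynomial (Fin n) ℤ) :=
  ∑ i, (MvPolynomial.X i : MvPolynomial (Fin n) ℤ) •
    (Algebra.leftMulMatrix ξ (ξ i)).map (MvPolynomial.C (σ := Fin n))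

/-- (The left-hand side of) the fundamental equation: the characteristic polynomial over
`ℤ[u₁, …, uₙ]` of the fundamental form `w₀ = u₁ξ₁ + ⋯ + uₙξₙ`. It is the product of `w - w_σ` over
all conjugates `w_σ` of `w₀`; see `map_fundamentalEquation`. -/
def fundamentalEquation (ξ : Module.Basis (Fin n) ℤ (𝓞 K)) : (MvPolynomial (Fin n) ℤ)[X] :=
  (fundamentalMatrix ξ).charpoly

/-- Over `ℂ`, the fundamental equation is the product of `w - (u₁σ(ξ₁) + ⋯ + uₙσ(ξₙ))` over all
embeddings `σ` of the field. -/
theorem map_fundamentalEquation (ξ : Module.Basis (Fin n) ℤ (𝓞 K)) :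
    (fundamentalEquation ξ).map (MvPolynomial.map (Int.castRingHom ℂ)) =
      ∏ σ : K →ₐ[ℚ] ℂ, (X - C (∑ i, MvPolynomial.X i * MvPolynomial.C (σ (ξ i : K)))) := by
  classical
  let b : Module.Basis (Fin n) ℚ K := ξ.localizationLocalization ℚ (nonZeroDivisors ℤ) K
  have hb : ∀ i, b i = (ξ i : K) := fun i => by
    simp [b, Module.Basis.localizationLocalization_apply]
  have hcard : Fintype.card (Fin n) = Fintype.card (K →ₐ[ℚ] ℂ) := by
    rw [AlgHom.card, Module.finrank_eq_card_basis b]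
  let e : Fin n ≃ (K →ₐ[ℚ] ℂ) := Fintype.equivOfCardEq hcard
  let V : Matrix (Fin n) (Fin n) ℂ := (Algebra.embeddingsMatrixReindex ℚ ℂ b e).transpose
  have hV : ∀ s j, V s j = e s (ξ j : K) := fun s j => by
    simp [V, Algebra.embeddingsMatrixReindex, Algebra.embeddingsMatrix, hb]
  have hdet : IsUnit V := by
    rw [Matrix.isUnit_iff_isUnit_det, isUnit_iff_ne_zero, Matrix.det_transpose]
    intro h0
    have h := Algebra.discr_eq_det_embeddingsMatrixReindex_pow_two ℚ ℂ b e
    rw [h0, zero_pow two_ne_zero, map_eq_zero] at h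
    exact Algebra.discr_not_zero_of_basis ℚ b h
  have hdet' : IsUnit (V.map (MvPolynomial.C (σ := Fin n))) :=
    hdet.map (RingHom.mapMatrix (MvPolynomial.C (σ := Fin n)))
  obtain ⟨W, hW⟩ := hdet'
  let D : Matrix (Fin n) (Fin n) (MvPolynomial (Fin n) ℂ) :=
    Matrix.diagonal fun s => ∑ i, MvPolynomial.X i * MvPolynomial.C (e s (ξ i : K))
  set A := (fundamentalMatrix ξ).map (MvPolynomial.map (Int.castRingHom ℂ)) with hA
  have key : ∀ s i j, ∑ k, e s (ξ k : K) * ((Algebra.leftMulMatrix ξ (ξ i) k j : ℤ) : ℂ) =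
      e s (ξ i : K) * e s (ξ j : K) := fun s i j => by
    have h1 : ∑ k, (Algebra.leftMulMatrix ξ (ξ i) k j) • ξ k = ξ i * ξ j := by
      simp_rw [Algebra.leftMulMatrix_eq_repr_mul]
      exact ξ.sum_repr _
    have h2 := congrArg (fun x : 𝓞 K => e s (x : K)) h1
    simp only [map_sum, zsmul_eq_mul, map_mul, map_intCast] at h2
    rw [← h2]
    exact Finset.sum_congr rfl fun k _ => mul_comm _ _
  have hcomm : (W : Matrix (Fin n) (Fin n) (MvPolynomial (Fin n) ℂ)) * A = D * W := by
    rw [hW]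
    ext1 s j
    have hAe : ∀ k, A k j = ∑ i, MvPolynomial.X i *
        MvPolynomial.C (((Algebra.leftMulMatrix ξ (ξ i) k j : ℤ) : ℂ)) := fun k => by
      simp [hA, fundamentalMatrix, Matrix.sum_apply]
    have hR : (D * V.map (MvPolynomial.C (σ := Fin n))) s j =
        (∑ i, MvPolynomial.X i * MvPolynomial.C (e s (ξ i : K))) *
          MvPolynomial.C (e s (ξ j : K)) := by
      rw [← hV s j]
      exact Matrix.diagonal_mul _ _ _ _
    rw [hR]
    simp only [Matrix.mul_apply, Matrix.map_apply, hV, hAe, Finset.mul_sum, Finset.sum_mul]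
    rw [Finset.sum_comm]
    refine Finset.sum_congr rfl fun i _ => ?_
    rw [mul_assoc, ← map_mul, ← key s i j, map_sum, Finset.mul_sum]
    refine Finset.sum_congr rfl fun k _ => ?_
    rw [map_mul]
    ring
  have hconj : A = (W⁻¹ : (Matrix (Fin n) (Fin n) (MvPolynomial (Fin n) ℂ))ˣ).1 * D * W.1 := by
    rw [mul_assoc, ← hcomm, ← mul_assoc, Units.inv_mul, one_mul]
  rw [fundamentalEquation, ← Matrix.charpoly_map, ← hA, hconj,
    show (W⁻¹ : (Matrix (Fin n) (Fin n) (MvPolynomial (Fin n) ℂ))ˣ).1 = W.1⁻¹ from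
      Matrix.coe_units_inv W, Matrix.charpoly_units_conj',
    Matrix.charpoly_diagonal]
  exact Fintype.prod_equiv e _ _ fun s => rfl

/-- The determinant `|a_{ik}|` of the coordinates of `1, θ, …, θ^{n-1}` in the integral basis `ξ`.
Its absolute value is the index of `ℤ[θ]` in the ring of integers if `θ` generates the field, and it
is `0` otherwise. -/
def indexDet (ξ : Module.Basis (Fin n) ℤ (𝓞 K)) (θ : 𝓞 K) : ℤ :=
  (ξ.toMatrix fun k : Fin n => θ ^ (k : ℕ)).det

/-- The inessential divisor `|a_{ik}|²` of the equation discriminant of `θ`. -/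
def inessentialDivisor (ξ : Module.Basis (Fin n) ℤ (𝓞 K)) (θ : 𝓞 K) : ℤ :=
  indexDet ξ θ ^ 2

/-- The equation discriminant of `θ`, i.e. the discriminant of `1, θ, …, θ^{n-1}`, is the inessential
divisor of `θ` times the discriminant of the field. -/
theorem discr_powers (ξ : Module.Basis (Fin n) ℤ (𝓞 K)) (θ : 𝓞 K) :
    Algebra.discr ℤ (fun k : Fin n => θ ^ (k : ℕ)) = inessentialDivisor ξ θ * discr K := by
  rw [← NumberField.discr_eq_discr K ξ, inessentialDivisor, indexDet,
    ← Algebra.discr_of_matrix_vecMul, Module.Basis.toMatrix_map_vecMul]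

/-- `p` is a common inessential divisor of all equation discriminants: for every algebraic integer
`θ` of the field, `p` divides the inessential divisor of the equation discriminant of `θ`. -/
def IsCommonInessentialDivisor (ξ : Module.Basis (Fin n) ℤ (𝓞 K)) (p : ℕ) : Prop :=
  ∀ θ : 𝓞 K, (p : ℤ) ∣ inessentialDivisor ξ θ

/-- `ḡ(κ) = (1/κ) ∑_{d ∣ κ} μ(κ/d) p^d`. -/
def gBar (p κ : ℕ) : ℚ :=
  (1 / (κ : ℚ)) * ∑ d ∈ κ.divisors, (ArithmeticFunction.moebius (κ / d) : ℚ) * (p : ℚ) ^ d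

end

end Hensel

/-! Parts 1 and 3 rest on the ring `𝓞 K / p` and the fundamental form `w₀`.

Part 1. The row of the `ξ j` is a left eigenvector of the fundamental matrix modulo `p`, with
eigenvalue `w₀`. Hence a polynomial over `𝔽_p[u]` kills that matrix iff it kills `w₀` in `(𝓞 K /
p)[u]`. For a prime `P` over `p`, let `Q P` be the minimal polynomial over `𝔽_p[u]` of `w₀` modulo
`P`. It is prime, its degree in `w` is the residue degree, and its constant term determines `P`. By
Cayley–Hamilton every `Q P` divides `F` modulo `p`. Conversely `∏ Q P` is nilpotent at `w₀`, so `F`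
divides a power of it. The irreducible factors are therefore exactly the `Q P`
(`exists_equiv_primesOver`).

Part 2. Compare degrees in the factorization of `X ^ p ^ κ - X` and apply Möbius inversion.

Part 3. If `p` does not divide `indexDet ξ θ`, then `θ` generates `𝓞 K / p` over `𝔽_p`, and the
minimal polynomials of `θ` modulo the various `P` are distinct irreducibles of the right degrees
(`ncard_primesOver_le_of_not_dvd`). Conversely, if there are enough irreducibles, assign distinct
ones `f P` to the primes and pick `θ` at which a lift of `f P` lies in `P` but not in `P ^ 2`. A
relation of degree `< n` for `θ` modulo `p` would be divisible by `∏ f P ^ e P`, which has degree `∑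
e P * deg (f P) = n` (`exists_not_dvd_indexDet`). -/

namespace Hensel

attribute [local instance] MvPolynomial.algebraMvPolynomial

noncomputable section

/-! ### Generic linear forms and their minimal polynomials over `k[u]`. -/

section

/-- The generic linear combination `∑ uᵢ xᵢ`, where the `uᵢ` are indeterminates. -/
def genericForm {ι B : Type*} [Fintype ι] [CommRing B] (x : ι → B) : MvPolynomial ι B :=
  ∑ i, MvPolynomial.X i * MvPolynomial.C (x i)

theorem map_genericForm {ι B C : Type*} [Fintype ι] [CommRing B] [CommRing C] (f : B →+* C)
    (x : ι → B) : MvPolynomial.map f (genericForm x) = genericForm (f ∘ x) := by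
  simp [genericForm]

theorem coeff_genericForm {ι B : Type*} [Fintype ι] [CommRing B] (x : ι → B) (i : ι) :
    MvPolynomial.coeff (Finsupp.single i 1) (genericForm x) = x i := by
  classical
  simp [genericForm, MvPolynomial.coeff_sum, mul_comm (MvPolynomial.X _),
    MvPolynomial.coeff_C_mul, MvPolynomial.coeff_X, Finsupp.single_left_inj]

theorem genericForm_injective {ι B : Type*} [Fintype ι] [CommRing B] :
    Function.Injective (genericForm : (ι → B) → MvPolynomial ι B) := fun x y h => by
  funext i
  rw [← coeff_genericForm x i, h, coeff_genericForm]

theorem aeval_genericForm_comp {ι k B C : Type*} [Fintype ι] [CommRing k] [CommRing B]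
    [CommRing C] [Algebra k B] [Algebra k C] (f : B →+* C)
    (hf : f.comp (algebraMap k B) = algebraMap k C) (x : ι → B) (G : (MvPolynomial ι k)[X]) :
    aeval (genericForm (f ∘ x)) G = MvPolynomial.map f (aeval (genericForm x) G) := by
  rw [← map_genericForm, aeval_def, aeval_def, hom_eval₂]
  congr 1
  refine RingHom.ext fun q => ?_
  rw [RingHom.comp_apply, MvPolynomial.algebraMap_def, MvPolynomial.algebraMap_def,
    MvPolynomial.map_map, hf]

/-- A basis of `L` over `k` is a basis of `L[u]` over `k[u]`. -/
def mvPolynomialBasis (ι k L : Type*) [Field k] [Field L] [Algebra k L]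
    [FiniteDimensional k L] :
    Module.Basis (Fin (Module.finrank k L)) (MvPolynomial ι k) (MvPolynomial ι L) :=
  (Algebra.TensorProduct.basis (MvPolynomial ι k) (Module.finBasis k L)).map
    (Algebra.IsPushout.equiv k (MvPolynomial ι k) L (MvPolynomial ι L)).toLinearEquiv

theorem finite_mvPolynomial (ι k L : Type*) [Field k] [Field L] [Algebra k L]
    [FiniteDimensional k L] :
    Module.Finite (MvPolynomial ι k) (MvPolynomial ι L) :=
  .of_basis (mvPolynomialBasis ι k L)

theorem genericForm_algEquiv_comp_injective {ι k L : Type*} [Fintype ι] [Field k] [Field L]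
    [Algebra k L] {x : ι → L} (hx : Submodule.span k (Set.range x) = ⊤) :
    Function.Injective fun τ : L ≃ₐ[k] L => genericForm (τ ∘ x) := fun τ τ' h => by
  have h1 := genericForm_injective h
  have h2 : τ.toLinearMap = τ'.toLinearMap := LinearMap.ext_on_range hx fun i => congrFun h1 i
  ext a
  exact congrArg (fun f => f a) h2

section minpoly

variable {ι k L : Type*} [Field k] [Field L] [Algebra k L] [FiniteDimensional k L]

theorem isIntegral_mvPolynomial (w : MvPolynomial ι L) : IsIntegral (MvPolynomial ι k) w :=
  have := finite_mvPolynomial ι k L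
  Algebra.IsIntegral.isIntegral w

/-- Cayley–Hamilton for multiplication by `w` on a free module of rank `[L : k]`; divisibility by
the minimal polynomial holds because `k[u]` is integrally closed. -/
theorem natDegree_minpoly_mvPolynomial_le (w : MvPolynomial ι L) :
    (minpoly (MvPolynomial ι k) w).natDegree ≤ Module.finrank k L := by
  have := finite_mvPolynomial ι k L
  have := Module.Free.of_basis (mvPolynomialBasis ι k L)
  have h := natDegree_le_of_dvd
    (minpoly.isIntegrallyClosed_dvd (isIntegral_mvPolynomial (k := k) w)
      (p := (Algebra.lmul (MvPolynomial ι k) (MvPolynomial ι L) w).charpoly) (by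
        have h1 := LinearMap.aeval_self_charpoly
          (Algebra.lmul (MvPolynomial ι k) (MvPolynomial ι L) w)
        rw [Polynomial.aeval_algHom_apply] at h1
        simpa using congrArg (fun f => f 1) h1)) (LinearMap.charpoly_monic _).ne_zero
  rwa [LinearMap.charpoly_natDegree, Module.finrank_eq_card_basis (mvPolynomialBasis ι k L),
    Fintype.card_fin] at h

variable [IsGalois k L] [Fintype ι] {x : ι → L}

/-- All conjugates of the form are roots, and they are distinct since the `x i` span `L`; the degree
bound leaves no room for another factor. -/
theorem map_minpoly_genericForm (hx : Submodule.span k (Set.range x) = ⊤) :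
    (minpoly (MvPolynomial ι k) (genericForm x)).map (algebraMap _ (MvPolynomial ι L)) =
      ∏ τ : L ≃ₐ[k] L, (X - C (genericForm (τ ∘ x))) := by
  have hint := isIntegral_mvPolynomial (k := k) (genericForm x)
  refine eq_of_monic_of_dvd_of_natDegree_le
    (monic_prod_of_monic _ _ fun τ _ => monic_X_sub_C (genericForm (τ ∘ x)))
    ((minpoly.monic hint).map _) ?_ ?_
  · have h := (Multiset.prod_X_sub_C_dvd_iff_le_roots ((minpoly.monic hint).map
      (algebraMap _ (MvPolynomial ι L))).ne_zero (Finset.univ.val.map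
        fun τ : L ≃ₐ[k] L => genericForm (τ ∘ x))).2 ?_
    · simpa [Multiset.map_map] using h
    · rw [Multiset.le_iff_subset
        ((Multiset.nodup_map_iff_of_injective (genericForm_algEquiv_comp_injective hx)).2
          Finset.univ.nodup)]
      intro w hw
      obtain ⟨τ, -, rfl⟩ := Multiset.mem_map.1 hw
      rw [mem_roots ((minpoly.monic hint).map _).ne_zero, IsRoot, eval_map_algebraMap]
      have h1 := aeval_genericForm_comp (k := k) (τ : L →+* L)
        (RingHom.ext fun a => τ.commutes a) x (minpoly (MvPolynomial ι k) (genericForm x))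
      rw [minpoly.aeval, map_zero] at h1
      exact h1
  · rw [(minpoly.monic hint).natDegree_map, natDegree_prod_of_monic _ _ fun _ _ => monic_X_sub_C _]
    simpa [← Nat.card_eq_fintype_card, IsGalois.card_aut_eq_finrank] using
      natDegree_minpoly_mvPolynomial_le (k := k) (genericForm x)

theorem natDegree_minpoly_genericForm (hx : Submodule.span k (Set.range x) = ⊤) :
    (minpoly (MvPolynomial ι k) (genericForm x)).natDegree = Module.finrank k L := by
  rw [← (minpoly.monic (isIntegral_mvPolynomial (k := k) (genericForm x))).natDegree_map
    (algebraMap _ (MvPolynomial ι L)), map_minpoly_genericForm hx,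
    natDegree_prod_of_monic _ _ fun _ _ => monic_X_sub_C _]
  simp [← Nat.card_eq_fintype_card, IsGalois.card_aut_eq_finrank]

/-- Up to sign, the constant term specialized at `c` is the norm of `∑ c i • x i`. With `L = 𝓞 K /
P` this lets the minimal polynomial recover `P`. -/
theorem eval_minpoly_genericForm_eq_zero_iff (hx : Submodule.span k (Set.range x) = ⊤)
    (c : ι → k) :
    MvPolynomial.eval c ((minpoly (MvPolynomial ι k) (genericForm x)).coeff 0) = 0 ↔
      ∑ i, c i • x i = 0 := by
  have h := congrArg (fun f => MvPolynomial.eval (algebraMap k L ∘ c) (f.coeff 0))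
    (map_minpoly_genericForm hx)
  have hτ : ∀ τ : L ≃ₐ[k] L, MvPolynomial.eval (algebraMap k L ∘ c) (genericForm (τ ∘ x)) =
      τ (∑ i, c i • x i) := fun τ => by
    simp [genericForm, Algebra.smul_def]
  simp only [coeff_zero_eq_eval_zero, eval_prod, eval_sub, eval_X, eval_C, map_prod, zero_sub,
    map_neg, hτ] at h
  rw [← coeff_zero_eq_eval_zero, coeff_map, MvPolynomial.algebraMap_def,
    MvPolynomial.eval_map, ← MvPolynomial.eval₂_comp] at h
  rw [← map_eq_zero_iff _ (algebraMap k L).injective, h, Finset.prod_eq_zero_iff]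
  simp only [Finset.mem_univ, true_and, neg_eq_zero, EmbeddingLike.map_eq_zero_iff, exists_const]

end minpoly

end

/-! ### Polynomials annihilating the fundamental matrix modulo `p`. -/

section

theorem sub_dvd_aeval_sub_aeval {R A : Type*} [CommRing R] [Ring A] [Algebra R A] {x y : A}
    (h : Commute x y) (G : R[X]) : x - y ∣ aeval x G - aeval y G := by
  induction G using Polynomial.induction_on' with
  | add f g hf hg =>
    rw [map_add, map_add, add_sub_add_comm]
    exact dvd_add hf hg
  | monomial k a =>
    obtain ⟨z, hz⟩ := h.sub_dvd_pow_sub_pow k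
    exact ⟨a • z, by rw [aeval_monomial, aeval_monomial, ← mul_sub, hz, ← Algebra.smul_def,
      mul_smul_comm]⟩

theorem map_aeval_matrix {m R S : Type*} [Fintype m] [DecidableEq m] [CommRing R] [CommRing S]
    [Algebra R S] (M : Matrix m m R) (G : R[X]) :
    (aeval M G).map (algebraMap R S) = aeval (M.map (algebraMap R S)) G :=
  (Polynomial.aeval_algHom_apply (Algebra.ofId R S).mapMatrix M G).symm

/-- Over `R[X]`, the matrix `X - M` divides `G(X) - G(M) = G(X)`, a scalar matrix; take
determinants. -/
theorem charpoly_dvd_pow_of_aeval_eq_zero {m R : Type*} [Fintype m] [DecidableEq m] [CommRing R]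
    {M : Matrix m m R} {G : R[X]} (h : aeval M G = 0) : M.charpoly ∣ G ^ Fintype.card m := by
  have h1 : M.charmatrix ∣ Matrix.scalar m G := by
    have h2 := sub_dvd_aeval_sub_aeval
      (Matrix.scalar_commute (X : R[X]) (Commute.all _) (M.map C)) G
    have h3 : aeval (Matrix.scalar m (X : R[X])) G = Matrix.scalar m G := by
      have h4 := Polynomial.aeval_algebraMap_apply (Matrix m m R[X]) (X : R[X]) G
      rwa [aeval_X_left_apply] at h4
    have h5 : aeval (M.map (C : R →+* R[X])) G = 0 := by
      rw [← Polynomial.algebraMap_eq, ← map_aeval_matrix, h]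
      simp
    rwa [h3, h5, sub_zero] at h2
  obtain ⟨N, hN⟩ := h1
  exact ⟨N.det, by rw [Matrix.charpoly, ← Matrix.det_mul, ← hN]; simp⟩

theorem vecMul_aeval {m R S : Type*} [Fintype m] [DecidableEq m] [CommRing R] [CommRing S]
    [Algebra R S] {M : Matrix m m R} {v : m → S} {w : S}
    (h : Matrix.vecMul v (M.map (algebraMap R S)) = w • v) (G : R[X]) :
    Matrix.vecMul v ((aeval M G).map (algebraMap R S)) = aeval w G • v := by
  rw [map_aeval_matrix]
  generalize M.map (algebraMap R S) = N at h
  induction G using Polynomial.induction_on' with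
  | add f g hf hg => rw [map_add, map_add, Matrix.vecMul_add, hf, hg, add_smul]
  | monomial k a =>
    have hk : Matrix.vecMul v (N ^ k) = w ^ k • v := by
      induction k with
      | zero => simp
      | succ k ih =>
        rw [pow_succ, ← Matrix.vecMul_vecMul, ih, Matrix.smul_vecMul, h, smul_smul, pow_succ]
    rw [aeval_monomial, aeval_monomial, ← Algebra.smul_def, Matrix.vecMul_smul, hk,
      ← Algebra.smul_def, smul_assoc]

variable {K : Type*} [Field K] {n : ℕ} (ξ : Module.Basis (Fin n) ℤ (𝓞 K)) (p : ℕ)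

/-- The reduction modulo `p` of the matrix of multiplication by the fundamental form. -/
def fundamentalMatrixMod : Matrix (Fin n) (Fin n) (MvPolynomial (Fin n) (ZMod p)) :=
  (fundamentalMatrix ξ).map (MvPolynomial.map (Int.castRingHom (ZMod p)))

theorem charpoly_fundamentalMatrixMod :
    (fundamentalMatrixMod ξ p).charpoly =
      (fundamentalEquation ξ).map (MvPolynomial.map (Int.castRingHom (ZMod p))) :=
  Matrix.charpoly_map _ _

section

variable {p} {B : Type*} [CommRing B] [Algebra (ZMod p) B] (φ : 𝓞 K →+* B)

/-- This is the multiplication table `ξ i * ξ j = ∑ k, a k • ξ k`, read as an eigenvector equation.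
-/
theorem vecMul_fundamentalMatrixMod :
    Matrix.vecMul (fun j => MvPolynomial.C (φ (ξ j)))
        ((fundamentalMatrixMod ξ p).map (algebraMap _ (MvPolynomial (Fin n) B))) =
      genericForm (φ ∘ ξ) • fun j => MvPolynomial.C (φ (ξ j)) := by
  funext j
  have hM : ∀ k, algebraMap _ (MvPolynomial (Fin n) B) (fundamentalMatrixMod ξ p k j) =
      ∑ i, MvPolynomial.X i * MvPolynomial.C (φ (Algebra.leftMulMatrix ξ (ξ i) k j : ℤ)) :=
    fun k => by
      rw [MvPolynomial.algebraMap_def]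
      simp [fundamentalMatrixMod, fundamentalMatrix, Matrix.sum_apply]
  simp only [Matrix.vecMul, dotProduct, Matrix.map_apply, hM, Pi.smul_apply, smul_eq_mul,
    genericForm, Finset.mul_sum, Finset.sum_mul]
  rw [Finset.sum_comm]
  refine Finset.sum_congr rfl fun i _ => ?_
  have h1 : ∑ k, (Algebra.leftMulMatrix ξ (ξ i) k j) • ξ k = ξ i * ξ j := by
    simp_rw [Algebra.leftMulMatrix_eq_repr_mul]
    exact ξ.sum_repr _
  rw [Function.comp_apply, mul_assoc, ← map_mul, ← map_mul, ← h1, map_sum, map_sum, Finset.mul_sum]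
  refine Finset.sum_congr rfl fun k _ => ?_
  rw [zsmul_eq_mul, map_mul, map_mul]
  ring

/-- Since the kernel of `φ` lies in `(p)`, the images of the `ξ j` stay linearly independent over
`𝔽_p`. -/
theorem eq_zero_of_sum_basis_mul_eq_zero (hφ : RingHom.ker φ ≤ Ideal.span {(p : 𝓞 K)})
    {c : Fin n → ZMod p}
    (hc : ∑ j, φ (ξ j) * algebraMap (ZMod p) B (c j) = 0) : c = 0 := by
  choose z hz using fun j => ZMod.intCast_surjective (c j)
  have h1 : ∑ j, z j • ξ j ∈ Ideal.span {(p : 𝓞 K)} := hφ (by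
    rw [RingHom.mem_ker, ← hc, map_sum]
    refine Finset.sum_congr rfl fun j _ => ?_
    rw [zsmul_eq_mul, map_mul, ← hz, map_intCast, map_intCast, mul_comm])
  obtain ⟨β, hβ⟩ := Ideal.mem_span_singleton'.1 h1
  funext j
  have h2 := congrArg (fun a => ξ.repr a j) hβ
  simp only [Module.Basis.repr_sum_self] at h2
  rw [mul_comm, ← nsmul_eq_mul, map_nsmul, Finsupp.smul_apply] at h2
  rw [← hz, ← h2]
  simp

theorem aeval_fundamentalMatrixMod_eq_zero_iff (hφ : RingHom.ker φ ≤ Ideal.span {(p : 𝓞 K)})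
    (G : (MvPolynomial (Fin n) (ZMod p))[X]) :
    aeval (fundamentalMatrixMod ξ p) G = 0 ↔ aeval (genericForm (φ ∘ ξ)) G = 0 := by
  have key := vecMul_aeval (vecMul_fundamentalMatrixMod ξ φ) G
  constructor
  · intro h
    -- The eigenvector equation gives `G(w₀) * φ (ξ j) = 0` for all `j`, and `1` is an integral
    -- combination of the `ξ j`.
    rw [h] at key
    have h1 : (1 : 𝓞 K) = ∑ j, ξ.repr 1 j • ξ j := (ξ.sum_repr 1).symm
    have h2 := congrArg (fun a => MvPolynomial.C (σ := Fin n) (φ a)) h1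
    simp only [map_one, map_sum, zsmul_eq_mul, map_mul] at h2
    rw [← mul_one (aeval _ G), h2, Finset.mul_sum]
    refine Finset.sum_eq_zero fun j _ => ?_
    have h3 := congrFun key j
    simp only [Matrix.map_zero, map_zero, Matrix.vecMul_zero, Pi.zero_apply, Pi.smul_apply,
      smul_eq_mul] at h3
    rw [mul_left_comm, ← h3, mul_zero]
  · intro h
    rw [h, zero_smul] at key
    -- For each monomial `m` in the `u`'s, the coefficients in column `j` form an `𝔽_p`-linear
    -- relation between the `φ (ξ i)`.
    ext i j m
    have h3 := congrArg (MvPolynomial.coeff m) (congrFun key j)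
    simp only [Matrix.vecMul, dotProduct, Matrix.map_apply, Pi.zero_apply,
      MvPolynomial.coeff_sum, MvPolynomial.coeff_C_mul, MvPolynomial.algebraMap_def,
      MvPolynomial.coeff_map, MvPolynomial.coeff_zero] at h3
    exact congrFun (eq_zero_of_sum_basis_mul_eq_zero ξ φ hφ h3) i

end

end

/-! ### Primes over `p` and the irreducible factors of the fundamental equation. -/

section

variable {K : Type*} [Field K] [NumberField K] {p : ℕ}

/-- The primes of the ring of integers over `p`. -/
abbrev PrimesOver (K : Type*) [Field K] (p : ℕ) : Set (Ideal (𝓞 K)) :=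
  Ideal.primesOver (Ideal.span {(p : ℤ)}) (𝓞 K)

theorem natCast_mem_of_mem_primesOver {K : Type*} [Field K] {p : ℕ} {P : Ideal (𝓞 K)}
    (hP : P ∈ PrimesOver K p) : (p : 𝓞 K) ∈ P := by
  have h := hP.2.over
  have h1 : (p : ℤ) ∈ P.under ℤ := h ▸ Ideal.mem_span_singleton_self _
  simpa [Ideal.under] using h1

theorem quotient_natCast_eq_zero {K : Type*} [Field K] {p : ℕ} {I : Ideal (𝓞 K)}
    (h : (p : 𝓞 K) ∈ I) : (p : 𝓞 K ⧸ I) = 0 := by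
  rw [← map_natCast (Ideal.Quotient.mk I)]
  exact Ideal.Quotient.eq_zero_iff_mem.2 h

/-- A quotient of the ring of integers by an ideal containing `p` is an algebra over the field with
`p` elements. -/
abbrev algebraQuotient {K : Type*} [Field K] {p : ℕ} {I : Ideal (𝓞 K)} (h : (p : 𝓞 K) ∈ I) :
    Algebra (ZMod p) (𝓞 K ⧸ I) :=
  ZMod.algebra' (𝓞 K ⧸ I) (ringChar (𝓞 K ⧸ I)) (ringChar.dvd (quotient_natCast_eq_zero h))

variable [Fact p.Prime]

theorem isMaximal_span_natCast : (Ideal.span {(p : ℤ)}).IsMaximal :=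
  PrincipalIdealRing.isMaximal_of_irreducible (Nat.prime_iff_prime_int.1 Fact.out).irreducible

theorem mem_primesOver_of_natCast_mem {K : Type*} [Field K] {P : Ideal (𝓞 K)} [hP : P.IsPrime]
    (h : (p : 𝓞 K) ∈ P) : P ∈ PrimesOver K p := by
  refine ⟨hP, ⟨isMaximal_span_natCast.eq_of_le (hP.under ℤ).ne_top ?_⟩⟩
  rw [Ideal.span_singleton_le_iff_mem]
  simpa [Ideal.under] using h

theorem ne_bot_of_mem_primesOver {P : Ideal (𝓞 K)} (hP : P ∈ PrimesOver K p) : P ≠ ⊥ := by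
  rintro rfl
  have h1 := natCast_mem_of_mem_primesOver hP
  rw [Ideal.mem_bot, Nat.cast_eq_zero] at h1
  exact (Fact.out : p.Prime).ne_zero h1

theorem isMaximal_of_mem_primesOver {P : Ideal (𝓞 K)} (hP : P ∈ PrimesOver K p) :
    P.IsMaximal :=
  hP.1.isMaximal (ne_bot_of_mem_primesOver hP)

theorem finite_primesOver : Finite (PrimesOver K p) := by
  have := isMaximal_span_natCast (p := p)
  exact Set.Finite.to_subtype (IsDedekindDomain.primesOver_finite _ _)

/-- Both numbers are the exponent of `p` in the cardinality of `𝓞 K ⧸ P`. -/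
theorem inertiaDeg_eq_finrank {P : Ideal (𝓞 K)} (hP : P ∈ PrimesOver K p)
    [Algebra (ZMod p) (𝓞 K ⧸ P)] : P.inertiaDeg ℤ = Module.finrank (ZMod p) (𝓞 K ⧸ P) := by
  have := isMaximal_span_natCast (p := p)
  have := isMaximal_of_mem_primesOver hP
  have := hP.2
  have := Ideal.finiteQuotientOfFreeOfNeBot P (ne_bot_of_mem_primesOver hP)
  have h1 := FiniteField.pow_finrank_eq_natCard p (𝓞 K ⧸ P)
  have h2 := Ideal.absNorm_eq_pow_inertiaDeg' P (Fact.out : p.Prime)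
  rw [Ideal.inertiaDeg'_eq_inertiaDeg, Ideal.absNorm_apply, Submodule.cardQuot_apply, ← h1] at h2
  exact (Nat.pow_right_injective (Fact.out : p.Prime).two_le h2).symm

variable {n : ℕ} (ξ : Module.Basis (Fin n) ℤ (𝓞 K))

theorem span_range_mk_basis {K : Type*} [Field K] (ξ : Module.Basis (Fin n) ℤ (𝓞 K))
    {I : Ideal (𝓞 K)} [Algebra (ZMod p) (𝓞 K ⧸ I)] :
    Submodule.span (ZMod p) (Set.range (Ideal.Quotient.mk I ∘ ξ)) = ⊤ := by
  refine eq_top_iff.2 fun a _ => ?_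
  obtain ⟨α, rfl⟩ := Ideal.Quotient.mk_surjective a
  rw [← ξ.sum_repr α, map_sum]
  refine Submodule.sum_mem _ fun i _ => ?_
  rw [map_zsmul]
  exact zsmul_mem (Submodule.subset_span (Set.mem_range_self i)) _

/-- The witness is the minimal polynomial of `w₀` modulo `P`. Divisibility is expressed through `𝓞 K
/ p` so that all primes test the same element. -/
theorem exists_primeForm [Algebra (ZMod p) (𝓞 K ⧸ Ideal.span {(p : 𝓞 K)})] {P : Ideal (𝓞 K)}
    (hP : P ∈ PrimesOver K p) :
    ∃ Q : (MvPolynomial (Fin n) (ZMod p))[X], Prime Q ∧ Q.natDegree = P.inertiaDeg ℤ ∧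
      (∀ c : Fin n → ℤ, MvPolynomial.eval (fun i => (c i : ZMod p)) (Q.coeff 0) = 0 ↔
        ∑ i, c i • ξ i ∈ P) ∧
      ∀ G, Q ∣ G ↔ MvPolynomial.map (Ideal.Quotient.factor ((Ideal.span_singleton_le_iff_mem P).2
        (natCast_mem_of_mem_primesOver hP)))
          (aeval (genericForm (Ideal.Quotient.mk (Ideal.span {(p : 𝓞 K)}) ∘ ξ)) G) = 0 := by
  have := isMaximal_of_mem_primesOver hP
  let : Field (𝓞 K ⧸ P) := Ideal.Quotient.field P
  let : Algebra (ZMod p) (𝓞 K ⧸ P) := algebraQuotient (natCast_mem_of_mem_primesOver hP)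
  have := Ideal.finiteQuotientOfFreeOfNeBot P (ne_bot_of_mem_primesOver hP)
  have : FiniteDimensional (ZMod p) (𝓞 K ⧸ P) := Module.Finite.of_finite
  have hspan := span_range_mk_basis ξ (p := p) (I := P)
  have hint := isIntegral_mvPolynomial (k := ZMod p) (genericForm (Ideal.Quotient.mk P ∘ ξ))
  refine ⟨minpoly (MvPolynomial (Fin n) (ZMod p)) (genericForm (Ideal.Quotient.mk P ∘ ξ)),
    minpoly.prime_of_isIntegrallyClosed hint, ?_, fun c => ?_, fun G => ?_⟩
  · rw [natDegree_minpoly_genericForm hspan, inertiaDeg_eq_finrank hP]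
  · rw [eval_minpoly_genericForm_eq_zero_iff hspan, ← Ideal.Quotient.eq_zero_iff_mem, map_sum]
    simp [Algebra.smul_def]
  · rw [← aeval_genericForm_comp _ (RingHom.ext_zmod _ _), ← minpoly.isIntegrallyClosed_dvd_iff hint]
    rfl

theorem exists_equiv_primesOver {h : ℕ} (𝔉 : Fin h → (MvPolynomial (Fin n) (ZMod p))[X])
    (δ : Fin h → ℕ) (h_irred : ∀ j, Irreducible (𝔉 j))
    (h_distinct : Pairwise fun i j => ¬ Associated (𝔉 i) (𝔉 j)) (h_pos : ∀ j, 0 < δ j)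
    (h_prod : (fundamentalEquation ξ).map (MvPolynomial.map (Int.castRingHom (ZMod p))) =
      ∏ j, 𝔉 j ^ δ j) :
    ∃ e : Fin h ≃ PrimesOver K p, ∀ j, (𝔉 j).natDegree = (e j).1.inertiaDeg ℤ := by
  let : Algebra (ZMod p) (𝓞 K ⧸ Ideal.span {(p : 𝓞 K)}) :=
    algebraQuotient (Ideal.mem_span_singleton_self _)
  have hker : RingHom.ker (Ideal.Quotient.mk (Ideal.span {(p : 𝓞 K)})) ≤ Ideal.span {(p : 𝓞 K)} :=
    Ideal.mk_ker.le
  have := finite_primesOver (K := K) (p := p)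
  have := Fintype.ofFinite (PrimesOver K p)
  rw [← charpoly_fundamentalMatrixMod] at h_prod
  choose Q hprime hdeg hev hdvd using fun P : PrimesOver K p => exists_primeForm ξ P.2
  -- Associated polynomials differ by a unit of `𝔽_p[u]`, so their constant terms vanish at the same
  -- integer points, which are the coordinates of the elements of `P`.
  have hinj : ∀ P P', Associated (Q P) (Q P') → P = P' := by
    intro P P' hPP'
    refine Subtype.ext (Ideal.ext fun α => ?_)
    obtain ⟨u, hu⟩ := hPP'
    obtain ⟨r, hr, hr'⟩ := Polynomial.isUnit_iff.1 u.isUnit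
    rw [← ξ.sum_repr α, ← hev, ← hev, ← hu, ← hr', coeff_mul_C, map_mul, mul_eq_zero,
      or_iff_left (hr.map _).ne_zero]
  have h1 : ∀ P, ∃ j, Associated (𝔉 j) (Q P) := by
    intro P
    have h2 : Q P ∣ (fundamentalMatrixMod ξ p).charpoly := by
      rw [hdvd, (aeval_fundamentalMatrixMod_eq_zero_iff ξ _ hker _).1
        (Matrix.aeval_self_charpoly _), map_zero]
    rw [h_prod, (hprime P).dvd_finsetProd_iff] at h2
    obtain ⟨j, -, hj⟩ := h2
    exact ⟨j, (((hprime P).irreducible.dvd_irreducible_iff_associated (h_irred j)).1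
      ((hprime P).dvd_of_dvd_pow hj)).symm⟩
  have h2 : ∃ N, (fundamentalMatrixMod ξ p).charpoly ∣ (∏ P, Q P) ^ N := by
    have hnil : IsNilpotent (aeval (genericForm (Ideal.Quotient.mk (Ideal.span {(p : 𝓞 K)}) ∘ ξ))
        (∏ P, Q P)) := by
      rw [nilpotent_iff_mem_prime]
      intro J hJ
      -- A prime `J` of `(𝓞 K / p)[u]` contracts to a prime `P` over `p`. The factor `Q P` puts
      -- every coefficient of the value in `P`, hence the value itself in `J`.
      let I := J.comap (MvPolynomial.C.comp (Ideal.Quotient.mk (Ideal.span {(p : 𝓞 K)})))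
      have hI : I.IsPrime := Ideal.comap_isPrime _ _
      have hp : (p : 𝓞 K) ∈ I := by
        rw [Ideal.mem_comap, RingHom.comp_apply,
          Ideal.Quotient.eq_zero_iff_mem.2 (Ideal.mem_span_singleton_self _), map_zero]
        exact zero_mem J
      let P : PrimesOver K p := ⟨I, mem_primesOver_of_natCast_mem hp⟩
      have h3 := (hdvd P _).1 (Finset.dvd_prod_of_mem Q (Finset.mem_univ P))
      revert h3
      generalize aeval (genericForm (Ideal.Quotient.mk (Ideal.span {(p : 𝓞 K)}) ∘ ξ))
        (∏ P, Q P) = q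
      intro h3
      refine Ideal.map_comap_le (f := MvPolynomial.C) (K := J) (MvPolynomial.mem_map_C_iff.2 ?_)
      intro m
      have h4 := congrArg (MvPolynomial.coeff m) h3
      rw [MvPolynomial.coeff_map, MvPolynomial.coeff_zero] at h4
      obtain ⟨α, hα⟩ := Ideal.Quotient.mk_surjective (MvPolynomial.coeff m q)
      rw [← hα, Ideal.Quotient.factor_mk, Ideal.Quotient.eq_zero_iff_mem] at h4
      rwa [← hα]
    obtain ⟨N, hN⟩ := hnil
    rw [← map_pow, ← aeval_fundamentalMatrixMod_eq_zero_iff ξ _ hker] at hN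
    have h3 := charpoly_dvd_pow_of_aeval_eq_zero hN
    rw [← pow_mul] at h3
    exact ⟨_, h3⟩
  have h3 : ∀ j, ∃ P, Associated (𝔉 j) (Q P) := by
    intro j
    obtain ⟨N, hN⟩ := h2
    have h4 : 𝔉 j ∣ (∏ P, Q P) ^ N := by
      refine dvd_trans ?_ hN
      rw [h_prod]
      exact (dvd_pow_self _ (h_pos j).ne').trans (Finset.dvd_prod_of_mem _ (Finset.mem_univ j))
    obtain ⟨P, -, hP⟩ := ((h_irred j).prime.dvd_finsetProd_iff _).1
      ((h_irred j).prime.dvd_of_dvd_pow h4)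
    exact ⟨P, ((h_irred j).dvd_irreducible_iff_associated (hprime P).irreducible).1 hP⟩
  choose e he using h3
  refine ⟨Equiv.ofBijective e ⟨fun i j hij => ?_, fun P => ?_⟩, fun j => ?_⟩
  · by_contra hne
    exact h_distinct hne ((he i).trans (hij ▸ (he j).symm))
  · obtain ⟨j, hj⟩ := h1 P
    exact ⟨j, hinj _ _ ((he j).symm.trans hj)⟩
  · rw [natDegree_eq_of_degree_eq (degree_eq_degree_of_associated (he j)), hdeg]
    rfl

end

/-! ### Counting monic irreducible polynomials over `𝔽_p`. -/

section

variable {p : ℕ} [Fact p.Prime]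

/-- The monic irreducible polynomials of degree `κ` over the field with `p` elements. -/
abbrev MonicIrreducible (p κ : ℕ) : Set (ZMod p)[X] :=
  {f | f.Monic ∧ Irreducible f ∧ f.natDegree = κ}

theorem finite_monicIrreducible (κ : ℕ) : (MonicIrreducible p κ).Finite := by
  have : Finite (degreeLT (ZMod p) (κ + 1)) :=
    Module.finite_of_finite (ZMod p)
  refine (Set.toFinite (degreeLT (ZMod p) (κ + 1) : Set (ZMod p)[X])).subset ?_
  rintro f ⟨-, hf, rfl⟩
  exact mem_degreeLT.2 ((degree_le_natDegree).trans_lt (by exact_mod_cast Nat.lt_succ_self _))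

/-- The left side is separable, hence squarefree, and an irreducible polynomial divides it iff its
degree divides `κ`. -/
theorem X_pow_sub_X_eq_prod {κ : ℕ} (hκ : 0 < κ) :
    (X ^ p ^ κ - X : (ZMod p)[X]) =
      ∏ d ∈ κ.divisors, ∏ f ∈ (finite_monicIrreducible (p := p) d).toFinset, f := by
  classical
  have hp1 : 1 < p := (Fact.out : p.Prime).one_lt
  have hmonic : (X ^ p ^ κ - X : (ZMod p)[X]).Monic :=
    monic_X_pow_sub (by rw [degree_X]; exact_mod_cast Nat.one_lt_pow hκ.ne' hp1)
  have hsep : (X ^ p ^ κ - X : (ZMod p)[X]).Separable :=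
    galois_poly_separable p (p ^ κ) (dvd_pow_self p hκ.ne')
  have hfac := UniqueFactorizationMonoid.prod_normalizedFactors_eq hmonic.ne_zero
  rw [hmonic.normalize_eq_self] at hfac
  have hnodup : (UniqueFactorizationMonoid.normalizedFactors (X ^ p ^ κ - X : (ZMod p)[X])).Nodup :=
    (UniqueFactorizationMonoid.squarefree_iff_nodup_normalizedFactors hmonic.ne_zero).1
      hsep.squarefree
  rw [← Finset.prod_biUnion, ← hfac]
  · have h : (κ.divisors.biUnion fun d => (finite_monicIrreducible (p := p) d).toFinset) =
        ⟨_, hnodup⟩ := by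
      ext f
      rw [Finset.mem_biUnion, Finset.mem_mk,
        UniqueFactorizationMonoid.mem_normalizedFactors_iff' hmonic.ne_zero]
      simp only [Set.Finite.mem_toFinset, Nat.mem_divisors, Set.mem_ofPred_eq]
      constructor
      · rintro ⟨d, ⟨hd, -⟩, hf, hirr, rfl⟩
        have h := hirr.natDegree_dvd_iff_dvd_X_pow_card_pow_sub_X.1 hd
        rw [Nat.card_zmod] at h
        exact ⟨hirr, hf.normalize_eq_self, h⟩
      · rintro ⟨hirr, hf, hdvd⟩
        have h := hirr.natDegree_dvd_iff_dvd_X_pow_card_pow_sub_X (n := κ)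
        rw [Nat.card_zmod] at h
        exact ⟨_, ⟨h.2 hdvd, hκ.ne'⟩, hf ▸ monic_normalize hirr.ne_zero, hirr, rfl⟩
    rw [h, Finset.prod_mk, Multiset.map_id']
  · intro d _ d' _ hne
    rw [Function.onFun, Finset.disjoint_left]
    intro f hf hf'
    rw [Set.Finite.mem_toFinset] at hf hf'
    exact hne (hf.2.2.symm.trans hf'.2.2)

theorem sum_ncard_monicIrreducible {κ : ℕ} (hκ : 0 < κ) :
    ∑ d ∈ κ.divisors, d * (MonicIrreducible p d).ncard = p ^ κ := by
  have h := congrArg natDegree (X_pow_sub_X_eq_prod (p := p) hκ)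
  rw [FiniteField.X_pow_card_pow_sub_X_natDegree_eq _ hκ.ne' (Fact.out : p.Prime).one_lt,
    natDegree_prod_of_monic] at h
  · rw [h]
    refine Finset.sum_congr rfl fun d _ => ?_
    rw [natDegree_prod_of_monic _ _ fun f hf => ((Set.Finite.mem_toFinset _).1 hf).1,
      Finset.sum_congr rfl fun f hf => ((Set.Finite.mem_toFinset _).1 hf).2.2, Finset.sum_const,
      smul_eq_mul, mul_comm, Set.ncard_eq_toFinset_card _ (finite_monicIrreducible d)]
  · exact fun d _ => monic_prod_of_monic _ _ fun f hf => ((Set.Finite.mem_toFinset _).1 hf).1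

theorem ncard_monicIrreducible {κ : ℕ} (hκ : 0 < κ) :
    ((MonicIrreducible p κ).ncard : ℚ) = gBar p κ := by
  have h := (ArithmeticFunction.sum_eq_iff_sum_mul_moebius_eq (R := ℚ)
    (f := fun d => (d : ℚ) * (MonicIrreducible p d).ncard) (g := fun d => (p : ℚ) ^ d)).1
    (fun m hm => by exact_mod_cast sum_ncard_monicIrreducible hm) κ hκ
  rw [Nat.sum_divisorsAntidiagonal' fun a b => (ArithmeticFunction.moebius a : ℚ) * (p : ℚ) ^ b] at h
  rw [gBar, h]
  have : (κ : ℚ) ≠ 0 := by exact_mod_cast hκ.ne'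
  field_simp

end

/-! ### Index determinants and the criterion for common inessential divisors. -/

section

section reduction

variable {K : Type*} [Field K] {p : ℕ}

theorem exists_eq_add_of_map_eq {g G : ℤ[X]}
    (h : g.map (Int.castRingHom (ZMod p)) = G.map (Int.castRingHom (ZMod p))) :
    ∃ r : ℤ[X], g = G + C (p : ℤ) * r := by
  have h1 : C (p : ℤ) ∣ g - G := by
    rw [C_dvd_iff_dvd_coeff]
    intro i
    have h2 := congrArg (fun f => f.coeff i) h
    simp only [coeff_map, eq_intCast] at h2
    rw [coeff_sub]
    exact (ZMod.intCast_eq_intCast_iff_dvd_sub _ _ _).1 h2.symm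
  obtain ⟨r, hr⟩ := h1
  exact ⟨r, by rw [← hr]; ring⟩

theorem aeval_mem_iff_of_map_eq {R : Type*} [CommRing R] {I : Ideal R} (hp : (p : R) ∈ I) (θ : R)
    {g G : ℤ[X]} (h : g.map (Int.castRingHom (ZMod p)) = G.map (Int.castRingHom (ZMod p))) :
    aeval θ g ∈ I ↔ aeval θ G ∈ I := by
  obtain ⟨r, rfl⟩ := exists_eq_add_of_map_eq h
  rw [map_add, map_mul, aeval_C, Ideal.add_mem_iff_left]
  refine I.mul_mem_right _ ?_
  simpa using hp

variable [Fact p.Prime]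

/-- If `g` did not divide `G` modulo `p`, a Bézout identity evaluated at `θ` would put `1` in `P`.
-/
theorem aeval_mem_iff_map_dvd {R : Type*} [CommRing R] {P : Ideal R} (hP : P ≠ ⊤)
    (hp : (p : R) ∈ P) {θ : R} {g : ℤ[X]} (hg : aeval θ g ∈ P)
    (hirr : Irreducible (g.map (Int.castRingHom (ZMod p)))) (G : ℤ[X]) :
    aeval θ G ∈ P ↔ g.map (Int.castRingHom (ZMod p)) ∣ G.map (Int.castRingHom (ZMod p)) := by
  have hsurj := Polynomial.map_surjective _ (ZMod.ringHom_surjective (Int.castRingHom (ZMod p)))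
  constructor
  · intro hG
    by_contra hdvd
    obtain ⟨a, b, hab⟩ := (hirr.coprime_iff_not_dvd (n := G.map _)).2 hdvd
    obtain ⟨a, rfl⟩ := hsurj a
    obtain ⟨b, rfl⟩ := hsurj b
    rw [← Polynomial.map_mul, ← Polynomial.map_mul, ← Polynomial.map_add,
      ← Polynomial.map_one (Int.castRingHom (ZMod p))] at hab
    have h1 := (aeval_mem_iff_of_map_eq hp θ hab).1 (by
      rw [map_add, map_mul, map_mul]
      exact P.add_mem (P.mul_mem_left _ hg) (P.mul_mem_left _ hG))
    rw [map_one] at h1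
    exact hP ((Ideal.eq_top_iff_one P).2 h1)
  · rintro ⟨q, hq⟩
    obtain ⟨q, rfl⟩ := hsurj q
    rw [← Polynomial.map_mul] at hq
    rw [aeval_mem_iff_of_map_eq hp θ hq, map_mul]
    exact P.mul_mem_right _ hg

/-- Here `(x) = P * J` with `P ∤ J`, so `P ^ k` cancels and the remaining factor `P` must divide
`(y)`. -/
theorem mem_of_pow_mul_mem_pow_succ {R : Type*} [CommRing R] [IsDedekindDomain R] {P : Ideal R}
    (hP : P.IsPrime) (hP0 : P ≠ ⊥) {x y : R} (hx : x ∈ P) (hx2 : x ∉ P ^ 2) {k : ℕ}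
    (h : x ^ k * y ∈ P ^ (k + 1)) : y ∈ P := by
  have hprime := Ideal.prime_of_isPrime hP0 hP
  obtain ⟨J, hJ⟩ := Ideal.dvd_span_singleton.2 hx
  have hJP : ¬ P ∣ J := by
    rintro ⟨J', rfl⟩
    exact hx2 (Ideal.dvd_span_singleton.1 ⟨J', by rw [hJ, pow_two, mul_assoc]⟩)
  have h1 := Ideal.dvd_span_singleton.2 h
  rw [← Ideal.span_singleton_mul_span_singleton, ← Ideal.span_singleton_pow, hJ, mul_pow, mul_assoc,
    pow_succ, mul_dvd_mul_iff_left (pow_ne_zero k hP0)] at h1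
  rcases hprime.dvd_or_dvd h1 with h2 | h2
  · exact absurd (hprime.dvd_of_dvd_pow h2) hJP
  · exact Ideal.dvd_span_singleton.1 h2

/-- One factor is gained at a time: if `G ≡ g ^ k * q` modulo `p` with `k < e`, then `g(θ) ^ k *
q(θ) ∈ P ^ (k + 1)`. As `g(θ)` has order exactly one at `P`, `q(θ) ∈ P` and `g` divides `q` modulo
`p`. -/
theorem map_pow_dvd_of_aeval_mem_pow {R : Type*} [CommRing R] [IsDedekindDomain R] {P : Ideal R}
    (hP : P.IsPrime) (hP0 : P ≠ ⊥) {e : ℕ} (hp : (p : R) ∈ P) (hpe : (p : R) ∈ P ^ e) {θ : R}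
    {g : ℤ[X]} (hg : aeval θ g ∈ P) (hg2 : aeval θ g ∉ P ^ 2)
    (hirr : Irreducible (g.map (Int.castRingHom (ZMod p)))) {G : ℤ[X]} (hG : aeval θ G ∈ P ^ e) :
    g.map (Int.castRingHom (ZMod p)) ^ e ∣ G.map (Int.castRingHom (ZMod p)) := by
  have hsurj := Polynomial.map_surjective _ (ZMod.ringHom_surjective (Int.castRingHom (ZMod p)))
  suffices ∀ k ≤ e, g.map (Int.castRingHom (ZMod p)) ^ k ∣ G.map (Int.castRingHom (ZMod p)) from
    this e le_rfl
  intro k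
  induction k with
  | zero => simp
  | succ k ih =>
    intro hk
    obtain ⟨q, hq⟩ := ih (Nat.le_of_succ_le hk)
    obtain ⟨q, rfl⟩ := hsurj q
    rw [hq, pow_succ]
    rw [← Polynomial.map_pow, ← Polynomial.map_mul] at hq
    rw [aeval_mem_iff_of_map_eq hpe θ hq, map_mul, map_pow] at hG
    exact mul_dvd_mul_left _ ((aeval_mem_iff_map_dvd hP.ne_top hp hg hirr q).1
      (mem_of_pow_mul_mem_pow_succ hP hP0 hg hg2 (Ideal.pow_le_pow_right hk hG)))

end reduction

variable {K : Type*} [Field K] [NumberField K] {p : ℕ} [Fact p.Prime]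

/-- The residue field contains a root of `f`, as its degree over `𝔽_p` is that of `f`. If a lift `α`
has `g(α) ∈ P ^ 2`, move it by `t ∈ P \ P ^ 2`: then `g(α + t) ≡ g(α) + g'(α) * t` modulo `P ^ 2`,
and `g'(α) ∉ P` by separability. -/
theorem exists_root_of_monicIrreducible {P : Ideal (𝓞 K)} (hP : P ∈ PrimesOver K p)
    {f : (ZMod p)[X]}
    (hf : f ∈ MonicIrreducible p (P.inertiaDeg ℤ)) (g : ℤ[X])
    (hg : g.map (Int.castRingHom (ZMod p)) = f) :
    ∃ α : 𝓞 K, aeval α g ∈ P ∧ aeval α g ∉ P ^ 2 := by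
  have := isMaximal_of_mem_primesOver hP
  have hP0 := ne_bot_of_mem_primesOver hP
  let : Field (𝓞 K ⧸ P) := Ideal.Quotient.field P
  let : Algebra (ZMod p) (𝓞 K ⧸ P) := algebraQuotient (natCast_mem_of_mem_primesOver hP)
  have := Ideal.finiteQuotientOfFreeOfNeBot P hP0
  have : Fact (Irreducible f) := ⟨hf.2.1⟩
  have : Finite (AdjoinRoot f) := by
    have := (AdjoinRoot.powerBasis hf.2.1.ne_zero).finite
    exact Module.finite_of_finite (ZMod p)
  have hfin : Module.finrank (ZMod p) (AdjoinRoot f) ∣ Module.finrank (ZMod p) (𝓞 K ⧸ P) := by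
    rw [← inertiaDeg_eq_finrank hP, ← hf.2.2, (AdjoinRoot.powerBasis hf.2.1.ne_zero).finrank,
      AdjoinRoot.powerBasis_dim]
  obtain ⟨φ⟩ := FiniteField.nonempty_algHom_of_finrank_dvd hfin
  obtain ⟨α, hα⟩ := Ideal.Quotient.mk_surjective (φ (AdjoinRoot.root f))
  have hmk : ∀ G : ℤ[X], Ideal.Quotient.mk P (aeval α G) =
      aeval (φ (AdjoinRoot.root f)) (G.map (Int.castRingHom (ZMod p))) := fun G => by
    rw [← hα, aeval_def, aeval_def, hom_eval₂, eval₂_map]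
    congr 1
    exact RingHom.ext_int _ _
  have hroot : aeval (φ (AdjoinRoot.root f)) f = 0 := by
    rw [aeval_algHom_apply, AdjoinRoot.aeval_eq, AdjoinRoot.mk_self, map_zero]
  have h0 : aeval α g ∈ P := by rw [← Ideal.Quotient.eq_zero_iff_mem, hmk, hg, hroot]
  have hsep : f.Separable := PerfectField.separable_of_irreducible hf.2.1
  have h1 : aeval α (derivative g) ∉ P := by
    rw [← Ideal.Quotient.eq_zero_iff_mem, hmk, ← derivative_map, hg]
    exact hsep.aeval_derivative_ne_zero hroot
  by_cases h2 : aeval α g ∈ P ^ 2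
  · obtain ⟨t, ht, ht2⟩ := P.exists_mem_pow_notMem_pow_succ hP0 hP.1.ne_top 1
    rw [pow_one] at ht
    obtain ⟨k, hk⟩ := (g.map (algebraMap ℤ (𝓞 K))).binomExpansion α t
    rw [derivative_map, eval_map_algebraMap, eval_map_algebraMap, eval_map_algebraMap] at hk
    have hkt : k * t ^ 2 ∈ P ^ 2 := Ideal.mul_mem_left _ _ (Ideal.pow_mem_pow ht 2)
    refine ⟨α + t, ?_, ?_⟩
    · rw [hk]
      exact P.add_mem (P.add_mem h0 (P.mul_mem_left _ ht)) (Ideal.pow_le_self two_ne_zero hkt)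
    · rw [hk, Ideal.add_mem_iff_left _ hkt, Ideal.add_mem_iff_right _ h2]
      intro h3
      refine h1 (mem_of_pow_mul_mem_pow_succ hP.1 hP0 ht ht2 (k := 1) ?_)
      rwa [pow_one, mul_comm]
  · exact ⟨α, h0, h2⟩

theorem aeval_sub_aeval_mem {R : Type*} [CommRing R] {I : Ideal R} {α β : R} (h : α - β ∈ I)
    (g : ℤ[X]) : aeval α g - aeval β g ∈ I := by
  have h1 := sub_dvd_eval_sub α β (g.map (algebraMap ℤ R))
  rw [eval_map_algebraMap, eval_map_algebraMap] at h1
  exact I.mem_of_dvd h1 h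

variable {n : ℕ} (ξ : Module.Basis (Fin n) ℤ (𝓞 K))

theorem aeval_sum_C_mul_X_pow {R : Type*} [CommRing R] {n : ℕ} (θ : R) (z : Fin n → ℤ) :
    aeval θ (∑ k : Fin n, C (z k) * X ^ (k : ℕ)) = ∑ k, z k • θ ^ (k : ℕ) := by
  rw [map_sum]
  refine Finset.sum_congr rfl fun k _ => ?_
  rw [map_mul, aeval_C, map_pow, aeval_X, algebraMap_int_eq, eq_intCast, zsmul_eq_mul]

theorem coeff_sum_C_mul_X_pow {R : Type*} [CommRing R] {n : ℕ} (z : Fin n → R) (k : Fin n) :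
    (∑ j : Fin n, C (z j) * X ^ (j : ℕ)).coeff (k : ℕ) = z k := by
  simp [finsetSum_coeff, coeff_X_pow, Fin.val_inj]

/-- By Cramer's rule `det • ξ j ∈ ℤ[θ]`, and the determinant is invertible modulo `p`. -/
theorem exists_aeval_sub_mem_span {K : Type*} [Field K] (ξ : Module.Basis (Fin n) ℤ (𝓞 K))
    {θ : 𝓞 K} (h : ¬ (p : ℤ) ∣ indexDet ξ θ) (α : 𝓞 K) :
    ∃ g : ℤ[X], α - aeval θ g ∈ Ideal.span {(p : 𝓞 K)} := by
  set M := ξ.toMatrix fun k : Fin n => θ ^ (k : ℕ) with hM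
  have hcop : IsCoprime (p : ℤ) M.det :=
    ((Nat.prime_iff_prime_int.1 Fact.out).irreducible.coprime_iff_not_dvd).2 h
  obtain ⟨a, d, had⟩ := hcop
  have hadj : ∀ j, ∑ k : Fin n, M.adjugate k j • θ ^ (k : ℕ) = M.det • ξ j := by
    intro j
    have h1 : ∀ k : Fin n, θ ^ (k : ℕ) = ∑ i, M i k • ξ i := fun k =>
      (ξ.sum_toMatrix_smul_self (fun k : Fin n => θ ^ (k : ℕ)) k).symm
    simp_rw [h1, Finset.smul_sum, smul_smul]
    rw [Finset.sum_comm]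
    simp_rw [← Finset.sum_smul]
    have h2 : ∀ i, ∑ k, M.adjugate k j * M i k = (M * M.adjugate) i j := fun i => by
      rw [Matrix.mul_apply]
      exact Finset.sum_congr rfl fun k _ => mul_comm _ _
    simp_rw [h2, Matrix.mul_adjugate, Matrix.smul_apply, Matrix.one_apply]
    simp
  refine ⟨∑ j, (d * ξ.repr α j) • ∑ k : Fin n, C (M.adjugate k j) * X ^ (k : ℕ), ?_⟩
  have h3 : aeval θ (∑ j, (d * ξ.repr α j) • ∑ k : Fin n, C (M.adjugate k j) * X ^ (k : ℕ)) =
      (d * M.det) • α := by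
    conv_rhs => rw [← ξ.sum_repr α]
    rw [map_sum, Finset.smul_sum]
    refine Finset.sum_congr rfl fun j _ => ?_
    rw [map_zsmul, aeval_sum_C_mul_X_pow, hadj, smul_smul, smul_smul, mul_right_comm]
  rw [h3, ← sub_eq_iff_eq_add'.2 had.symm, sub_smul, one_smul, sub_sub_cancel,
    zsmul_eq_mul]
  refine Ideal.mem_span_singleton.2 ⟨a * α, ?_⟩
  push_cast
  ring

theorem exists_monicIrreducible_aeval_mem_iff {θ : 𝓞 K}
    (hθ : ∀ α, ∃ g : ℤ[X], α - aeval θ g ∈ Ideal.span {(p : 𝓞 K)}) {P : Ideal (𝓞 K)}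
    (hP : P ∈ PrimesOver K p) : ∃ f ∈ MonicIrreducible p (P.inertiaDeg ℤ), ∀ g : ℤ[X],
      aeval θ g ∈ P ↔ f ∣ g.map (Int.castRingHom (ZMod p)) := by
  have := isMaximal_of_mem_primesOver hP
  let : Field (𝓞 K ⧸ P) := Ideal.Quotient.field P
  let : Algebra (ZMod p) (𝓞 K ⧸ P) := algebraQuotient (natCast_mem_of_mem_primesOver hP)
  have := Ideal.finiteQuotientOfFreeOfNeBot P (ne_bot_of_mem_primesOver hP)
  have hint : IsIntegral (ZMod p) (Ideal.Quotient.mk P θ) := Algebra.IsIntegral.isIntegral _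
  have hmk : ∀ G : ℤ[X], Ideal.Quotient.mk P (aeval θ G) =
      aeval (Ideal.Quotient.mk P θ) (G.map (Int.castRingHom (ZMod p))) := fun G => by
    rw [aeval_def, aeval_def, hom_eval₂, eval₂_map]
    congr 1
    exact RingHom.ext_int _ _
  refine ⟨minpoly (ZMod p) (Ideal.Quotient.mk P θ), ⟨minpoly.monic hint,
    minpoly.irreducible hint, ?_⟩, fun g => ?_⟩
  · rw [inertiaDeg_eq_finrank hP, ← Field.primitive_element_iff_minpoly_natDegree_eq]
    refine eq_top_iff.2 fun a _ => ?_
    obtain ⟨α, rfl⟩ := Ideal.Quotient.mk_surjective a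
    obtain ⟨g, hg⟩ := hθ α
    have h1 : Ideal.Quotient.mk P α = Ideal.Quotient.mk P (aeval θ g) :=
      Ideal.Quotient.eq.2 ((Ideal.span_singleton_le_iff_mem P).2
        (natCast_mem_of_mem_primesOver hP) hg)
    rw [h1, hmk]
    exact (IntermediateField.algebra_adjoin_le_adjoin _ _) (aeval_mem_adjoin_singleton _ _)
  · rw [← Ideal.Quotient.eq_zero_iff_mem, hmk, minpoly.dvd_iff]

theorem ncard_primesOver_le_of_not_dvd {θ : 𝓞 K} (h : ¬ (p : ℤ) ∣ indexDet ξ θ) (κ : ℕ) :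
    {P : Ideal (𝓞 K) | P ∈ PrimesOver K p ∧ P.inertiaDeg ℤ = κ}.ncard ≤
      (MonicIrreducible p κ).ncard := by
  classical
  have hθ := exists_aeval_sub_mem_span ξ h
  choose f hf hfg using fun P : PrimesOver K p => exists_monicIrreducible_aeval_mem_iff hθ P.2
  -- The value `0` off the primes over `p` is never used. Injectivity holds because every `α` is
  -- some `g(θ)` modulo `p`, and `α ∈ P` iff `f P` divides `g` modulo `p`.
  refine Set.ncard_le_ncard_of_injOn (fun P => if hP : P ∈ PrimesOver K p then f ⟨P, hP⟩ else 0)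
    ?_ ?_ (finite_monicIrreducible κ)
  · rintro P ⟨hP, rfl⟩
    simpa only [dif_pos hP] using hf ⟨P, hP⟩
  · rintro P ⟨hP, -⟩ P' ⟨hP', -⟩ heq
    simp only [dif_pos hP, dif_pos hP'] at heq
    have key : ∀ Q : PrimesOver K p, ∀ {α : 𝓞 K} {g : ℤ[X]},
        α - aeval θ g ∈ Ideal.span {(p : 𝓞 K)} →
          (α ∈ Q.1 ↔ f Q ∣ g.map (Int.castRingHom (ZMod p))) := by
      intro Q α g hg
      rw [← hfg, ← sub_add_cancel α (aeval θ g), Ideal.add_mem_iff_right]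
      exact (Ideal.span_singleton_le_iff_mem Q.1).2 (natCast_mem_of_mem_primesOver Q.2) hg
    ext α
    obtain ⟨g, hg⟩ := hθ α
    rw [key ⟨P, hP⟩ hg, key ⟨P', hP'⟩ hg, heq]

/-- The coefficients of `G` lift a nonzero kernel vector of the coordinate matrix modulo `p`. -/
theorem exists_polynomial_of_dvd_indexDet {K : Type*} [Field K] (ξ : Module.Basis (Fin n) ℤ (𝓞 K))
    {θ : 𝓞 K} (h : (p : ℤ) ∣ indexDet ξ θ) :
    ∃ G : ℤ[X], aeval θ G ∈ Ideal.span {(p : 𝓞 K)} ∧ G.map (Int.castRingHom (ZMod p)) ≠ 0 ∧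
      G.natDegree < n := by
  set M := ξ.toMatrix fun k : Fin n => θ ^ (k : ℕ) with hM
  have hdet : (M.map (Int.castRingHom (ZMod p))).det = 0 := by
    rw [← RingHom.mapMatrix_apply, ← RingHom.map_det, eq_intCast]
    exact (ZMod.intCast_zmod_eq_zero_iff_dvd _ _).2 h
  obtain ⟨c, hc0, hc⟩ := Matrix.exists_mulVec_eq_zero_iff.2 hdet
  choose z hz using fun j => ZMod.intCast_surjective (c j)
  have hmem : ∀ i, (p : ℤ) ∣ ∑ k, M i k * z k := fun i => by
    rw [← ZMod.intCast_zmod_eq_zero_iff_dvd]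
    have h1 := congrFun hc i
    simp only [Matrix.mulVec, dotProduct, Matrix.map_apply, eq_intCast, Pi.zero_apply, ← hz] at h1
    exact_mod_cast h1
  obtain ⟨k₀, hk₀⟩ := Function.ne_iff.1 hc0
  have hn : 0 < n := k₀.pos
  refine ⟨∑ k : Fin n, C (z k) * X ^ (k : ℕ), ?_, ?_, ?_⟩
  · have h1 : ∀ k : Fin n, θ ^ (k : ℕ) = ∑ i, M i k • ξ i := fun k =>
      (ξ.sum_toMatrix_smul_self (fun k : Fin n => θ ^ (k : ℕ)) k).symm
    rw [aeval_sum_C_mul_X_pow]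
    simp_rw [h1, Finset.smul_sum, smul_smul]
    rw [Finset.sum_comm]
    refine Ideal.sum_mem _ fun i _ => ?_
    rw [← Finset.sum_smul]
    obtain ⟨t, ht⟩ := hmem i
    rw [Finset.sum_congr rfl fun k _ => mul_comm (z k) (M i k), ht, zsmul_eq_mul]
    refine Ideal.mul_mem_right _ _ (Ideal.mem_span_singleton.2 ⟨t, by push_cast; rfl⟩)
  · intro h0
    have h1 := Polynomial.ext_iff.1 h0 k₀
    rw [coeff_map, coeff_sum_C_mul_X_pow, eq_intCast, hz, coeff_zero] at h1
    exact hk₀ h1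
  · refine lt_of_le_of_lt (natDegree_sum_le_of_forall_le _ _ (n := n - 1) fun k _ => ?_)
      (Nat.sub_lt hn one_pos)
    exact (natDegree_C_mul_X_pow_le _ _).trans (Nat.le_sub_one_of_lt k.2)

theorem natCast_mem_pow_ramificationIdx {P : Ideal (𝓞 K)} (hP : P ∈ PrimesOver K p) :
    (p : 𝓞 K) ∈ P ^ P.ramificationIdx ℤ := by
  have := hP.1
  have := hP.2
  have hmap : (Ideal.span {(p : ℤ)}).map (algebraMap ℤ (𝓞 K)) = Ideal.span {(p : 𝓞 K)} := by
    rw [Ideal.map_span, Set.image_singleton]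
    simp
  have hne : (Ideal.span {(p : ℤ)}).map (algebraMap ℤ (𝓞 K)) ≠ ⊥ := by
    rw [hmap, Ne, Ideal.span_singleton_eq_bot, Nat.cast_eq_zero]
    exact (Fact.out : p.Prime).ne_zero
  rw [Ideal.IsDedekindDomain.ramificationIdx_eq_multiplicity (Ideal.span {(p : ℤ)}) P hne, hmap,
    ← Ideal.dvd_span_singleton]
  exact pow_multiplicity_dvd _ _

theorem sum_ramificationIdx_mul_inertiaDeg [Fintype (PrimesOver K p)]
    (ξ : Module.Basis (Fin n) ℤ (𝓞 K)) :
    ∑ P : PrimesOver K p, P.1.ramificationIdx ℤ * P.1.inertiaDeg ℤ = n := by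
  have := (isMaximal_span_natCast (p := p)).isPrime
  rw [Ideal.sum_ramification_inertia_eq_finrank, Module.finrank_eq_card_basis ξ, Fintype.card_fin]

theorem exists_not_dvd_indexDet
    (hle : ∀ κ, {P : Ideal (𝓞 K) | P ∈ PrimesOver K p ∧ P.inertiaDeg ℤ = κ}.ncard ≤
      (MonicIrreducible p κ).ncard) :
    ∃ θ : 𝓞 K, ¬ (p : ℤ) ∣ indexDet ξ θ := by
  have hfinite := finite_primesOver (K := K) (p := p)
  have := Fintype.ofFinite (PrimesOver K p)
  have hsurj := Polynomial.map_surjective _ (ZMod.ringHom_surjective (Int.castRingHom (ZMod p)))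
  -- For each degree separately, the counting hypothesis gives an injection from primes to
  -- irreducibles; different degrees cannot collide.
  have hF : ∀ κ, ∃ F : Ideal (𝓞 K) → (ZMod p)[X],
      {P : Ideal (𝓞 K) | P ∈ PrimesOver K p ∧ P.inertiaDeg ℤ = κ} ⊆ F ⁻¹' MonicIrreducible p κ ∧
      Set.InjOn F {P : Ideal (𝓞 K) | P ∈ PrimesOver K p ∧ P.inertiaDeg ℤ = κ} := fun κ => by
    have hfin : {P : Ideal (𝓞 K) | P ∈ PrimesOver K p ∧ P.inertiaDeg ℤ = κ}.Finite :=
      (Set.toFinite (PrimesOver K p)).subset fun P hP => hP.1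
    refine hfin.exists_injOn_of_encard_le ?_
    rw [← hfin.cast_ncard_eq, ← (finite_monicIrreducible κ).cast_ncard_eq]
    exact_mod_cast hle κ
  choose F hFmem hFinj using hF
  let f : PrimesOver K p → (ZMod p)[X] := fun P => F (P.1.inertiaDeg ℤ) P.1
  have hf : ∀ P, f P ∈ MonicIrreducible p (P.1.inertiaDeg ℤ) := fun P => hFmem _ ⟨P.2, rfl⟩
  have hfinj : Function.Injective f := fun P P' h => by
    have hdeg : P.1.inertiaDeg ℤ = P'.1.inertiaDeg ℤ := by
      rw [← (hf P).2.2, ← (hf P').2.2, h]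
    refine Subtype.ext (hFinj (P'.1.inertiaDeg ℤ) ⟨P.2, hdeg⟩ ⟨P'.2, rfl⟩ ?_)
    have h1 : F (P.1.inertiaDeg ℤ) P.1 = F (P'.1.inertiaDeg ℤ) P'.1 := h
    rwa [hdeg] at h1
  choose g hg using fun P => hsurj (f P)
  choose α hα hα2 using fun P : PrimesOver K p =>
    exists_root_of_monicIrreducible P.2 (hf P) (g P) (hg P)
  -- The Chinese remainder theorem is applied modulo `P ^ 2`, the precision at which `g P` having
  -- order exactly one at `P` is preserved.
  obtain ⟨θ, hθ⟩ := IsDedekindDomain.exists_forall_sub_mem_ideal (s := Finset.univ)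
    (fun P : PrimesOver K p => P.1) (fun _ => 2)
    (fun P _ => Ideal.prime_of_isPrime (ne_bot_of_mem_primesOver P.2) P.2.1)
    (fun P _ P' _ h => fun h' => h (Subtype.ext h')) (fun P => α P.1)
  have hθ1 : ∀ P, aeval θ (g P) - aeval (α P) (g P) ∈ P.1 ^ 2 := fun P =>
    aeval_sub_aeval_mem (hθ P (Finset.mem_univ P)) _
  have hθ2 : ∀ P, aeval θ (g P) ∈ P.1 := fun P => by
    rw [← sub_add_cancel (aeval θ (g P)) (aeval (α P) (g P))]
    exact P.1.add_mem (Ideal.pow_le_self two_ne_zero (hθ1 P)) (hα P)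
  have hθ3 : ∀ P, aeval θ (g P) ∉ P.1 ^ 2 := fun P => by
    rw [← sub_add_cancel (aeval θ (g P)) (aeval (α P) (g P)), Ideal.add_mem_iff_right _ (hθ1 P)]
    exact hα2 P
  refine ⟨θ, fun hdvd => ?_⟩
  obtain ⟨G, hGmem, hG0, hGdeg⟩ := exists_polynomial_of_dvd_indexDet ξ hdvd
  have hpow : ∀ P : PrimesOver K p,
      f P ^ P.1.ramificationIdx ℤ ∣ G.map (Int.castRingHom (ZMod p)) := fun P => by
    have hpe := natCast_mem_pow_ramificationIdx P.2
    rw [← hg P]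
    exact map_pow_dvd_of_aeval_mem_pow P.2.1 (ne_bot_of_mem_primesOver P.2)
      (natCast_mem_of_mem_primesOver P.2) hpe (hθ2 P) (hθ3 P) (hg P ▸ (hf P).2.1)
      ((Ideal.span_singleton_le_iff_mem _).2 hpe hGmem)
  have hprod : ∏ P : PrimesOver K p, f P ^ P.1.ramificationIdx ℤ ∣
      G.map (Int.castRingHom (ZMod p)) := by
    refine Fintype.prod_dvd_of_coprime (fun P P' hne => IsCoprime.pow ?_) hpow
    rw [(hf P).2.1.coprime_iff_not_dvd]
    intro h
    exact hne (hfinj (eq_of_monic_of_associated (hf P).1 (hf P').1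
      (((hf P).2.1.dvd_irreducible_iff_associated (hf P').2.1).1 h)))
  have hle' := (natDegree_le_of_dvd hprod hG0).trans natDegree_map_le
  rw [natDegree_prod_of_monic _ _ fun P _ => (hf P).1.pow _,
    Finset.sum_congr rfl fun P _ => by rw [(hf P).1.natDegree_pow, (hf P).2.2],
    sum_ramificationIdx_mul_inertiaDeg ξ] at hle'
  exact absurd hGdeg hle'.not_gt

theorem isCommonInessentialDivisor_iff : IsCommonInessentialDivisor ξ p ↔
    ∃ κ, (MonicIrreducible p κ).ncard <
      {P : Ideal (𝓞 K) | P ∈ PrimesOver K p ∧ P.inertiaDeg ℤ = κ}.ncard := by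
  have h : IsCommonInessentialDivisor ξ p ↔ ∀ θ, (p : ℤ) ∣ indexDet ξ θ :=
    forall_congr' fun θ => (Nat.prime_iff_prime_int.1 Fact.out).dvd_pow_iff_dvd two_ne_zero
  rw [h]
  constructor
  · contrapose!
    exact exists_not_dvd_indexDet ξ
  · rintro ⟨κ, hκ⟩ θ
    by_contra hθ
    exact hκ.not_ge (ncard_primesOver_le_of_not_dvd ξ hθ κ)

end

end

end Hensel

theorem mainTheorem1 {K : Type*} [Field K] [NumberField K] {n : ℕ}
    (ξ : Module.Basis (Fin n) ℤ (𝓞 K)) (p : ℕ) [Fact p.Prime]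
    {h : ℕ} (𝔉 : Fin h → (MvPolynomial (Fin n) (ZMod p))[X]) (δ : Fin h → ℕ)
    (h_irred : ∀ j, Irreducible (𝔉 j))
    (h_distinct : Pairwise fun i j => ¬ Associated (𝔉 i) (𝔉 j))
    (h_pos : ∀ j, 0 < δ j)
    (h_prod : (Hensel.fundamentalEquation ξ).map (MvPolynomial.map (Int.castRingHom (ZMod p))) =
      ∏ j, 𝔉 j ^ δ j) :
    (∀ κ : ℕ, {j : Fin h | (𝔉 j).natDegree = κ}.ncard =
      {P : Ideal (𝓞 K) | P ∈ Ideal.primesOver (Ideal.span {(p : ℤ)}) (𝓞 K) ∧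
        P.inertiaDeg ℤ = κ}.ncard) ∧
    (∀ κ : ℕ, 0 < κ →
      ({f : (ZMod p)[X] | f.Monic ∧ Irreducible f ∧ f.natDegree = κ}.ncard : ℚ) =
        Hensel.gBar p κ) ∧
    (Hensel.IsCommonInessentialDivisor ξ p ↔
      ∃ κ ∈ Set.range fun j => (𝔉 j).natDegree,
        Hensel.gBar p κ < ({j : Fin h | (𝔉 j).natDegree = κ}.ncard : ℚ)) := by
  obtain ⟨e, he⟩ := Hensel.exists_equiv_primesOver ξ 𝔉 δ h_irred h_distinct h_pos h_prod
  have hcount : ∀ κ : ℕ, {j : Fin h | (𝔉 j).natDegree = κ}.ncard =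
      {P : Ideal (𝓞 K) | P ∈ Hensel.PrimesOver K p ∧ P.inertiaDeg ℤ = κ}.ncard := fun κ => by
    refine Set.ncard_congr (fun j _ => (e j).1) (fun j hj => ⟨(e j).2, (he j).symm.trans hj⟩)
      (fun i j _ _ hij => e.injective (Subtype.ext hij)) ?_
    rintro P ⟨hP, hκ⟩
    exact ⟨e.symm ⟨P, hP⟩, by simp [he, hκ], by simp⟩
  have hgauss : ∀ κ : ℕ, 0 < κ →
      ((Hensel.MonicIrreducible p κ).ncard : ℚ) = Hensel.gBar p κ :=
    fun κ hκ => Hensel.ncard_monicIrreducible hκ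
  refine ⟨hcount, hgauss, ?_⟩
  rw [Hensel.isCommonInessentialDivisor_iff]
  constructor
  · rintro ⟨κ, hκ⟩
    rw [← hcount] at hκ
    -- The strict inequality forces some factor to have degree `κ`. Being a residue degree, `κ` is
    -- positive, as the formula for `gBar` requires.
    obtain ⟨j, rfl⟩ := Set.nonempty_of_ncard_ne_zero (Nat.ne_zero_of_lt hκ)
    have := (e j).2.1
    refine ⟨_, ⟨j, rfl⟩, ?_⟩
    dsimp only
    rw [← hgauss _ (by rw [he]; exact Ideal.inertiaDeg_pos _ _)]
    exact_mod_cast hκ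
  · rintro ⟨_, ⟨j, rfl⟩, hκ⟩
    have := (e j).2.1
    dsimp only at hκ
    rw [← hgauss _ (by rw [he]; exact Ideal.inertiaDeg_pos _ _), hcount] at hκ
    exact ⟨_, by exact_mod_cast hκ⟩
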